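/- Let $n$ and $k$ be nonnegative integers, let $Y$ be a separable real Banach space with dual $Y^*$, and let $T \in \mathscr D'(\mathbf R^n, Y)$, that is, $T$ is a continuous linear map from the space $\mathscr D(\mathbf R^n, Y)$ of smooth compactly supported functions $\mathbf R^n \to Y$ (with its usual locally convex inductive limit topology) to $\mathbf R$. $T$ is called pointwise differentiable of order $k$ at $a \in \mathbf R^n$ if there is a polynomial function $P : \mathbf R^n \to Y^*$ of degree at most $k$ such that, with $S(\phi) = \int P(x)(\phi(x)) \, d\mathscr L^n x$, $$\lim_{r \to 0+} r^{-k-n} (T-S)_x\big(\phi(r^{-1}(x-a))\big) = 0 \quad \text{for all } \phi \in \mathscr D(\mathbf R^n, Y);$$ such $P$ is unique, and one sets $\operatorname{pt} D^k T(a) = D^k P(a)$, an element of the normed space $Z_k = \bigodot^k(\mathbf R^n, Y^*)$ of symmetric $k$-linear maps $(\mathbf R^n)^k \to Y^*$. The $Y \otimes \bigodot_k \mathbf R^n$ topology on $Z_k$ is the topology of pointwise convergence on the tensor product of $Y$ and the $k$-th symmetric power of $\mathbf R^n$ under the pairing $\langle y \otimes (v_1 \odot \cdots \odot v_k), \psi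 \rangle = \psi(v_1, \ldots, v_k)(y)$. Let $A$ be the set of points at which $T$ is pointwise differentiable of order $k$. Then: 1. $A$ is a Borel subset of $\mathbf R^n$. 2. The function $A \to Z_k$, $a \mapsto \operatorname{pt} D^k T(a)$, is a Borel function (preimages of open sets are Borel) when $Z_k$ carries the $Y \otimes \bigodot_k \mathbf R^n$ topology. 3. For each $y \in Y$, the function mapping $a \in A$ onto the real valued symmetric $k$-linear map $(v_1, \ldots, v_k) \mapsto \operatorname{pt} D^k T(a)(v_1, \ldots, v_k)(y)$ is a Borel function. 4. If $Y^*$ is separable, then $a \mapsto \operatorname{pt} D^k T(a)$ is a Borel function on $A$ when $Z_k$ carries its norm topology. -/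

import Mathlib

open scoped Distributions TensorProduct Topology
open Filter MeasureTheory TopologicalSpace

noncomputable section

namespace PtDiff

/-- Euclidean space `ℝⁿ`. -/
abbrev E (n : ℕ) : Type := EuclideanSpace ℝ (Fin n)

/-- The space `𝓓(ℝⁿ, Y)` of `Y`-valued smooth functions with compact support on `ℝⁿ`, with its
locally convex inductive limit topology. -/
abbrev TestFn (n : ℕ) (Y : Type*) [NormedAddCommGroup Y] [NormedSpace ℝ Y] :=
  𝓓((⊤ : Opens (E n)), Y)

/-- The space `𝓓'(ℝⁿ, Y)` of distributions of type `Y`: continuous linear maps from `𝓓(ℝⁿ, Y)`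
to `ℝ`. -/
abbrev Distrib (n : ℕ) (Y : Type*) [NormedAddCommGroup Y] [NormedSpace ℝ Y] :=
  TestFn n Y →L[ℝ] ℝ

/-- The normed space `⨀ᵏ(ℝⁿ, Z)` of symmetric `k`-linear maps from `(ℝⁿ)ᵏ` to `Z`, with the
supremum norm over `k`-tuples of vectors of length at most one (the operator norm). -/
def SymMap (n k : ℕ) (Z : Type*) [NormedAddCommGroup Z] [NormedSpace ℝ Z] :
    Submodule ℝ (ContinuousMultilinearMap ℝ (fun _ : Fin k => E n) Z) where
  carrier := {f | ∀ (σ : Equiv.Perm (Fin k)) (v : Fin k → E n), f (v ∘ σ) = f v}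
  add_mem' := by
    intro f g hf hg σ v
    simp [hf σ v, hg σ v]
  zero_mem' := by
    intro σ v
    simp
  smul_mem' := by
    intro c f hf σ v
    simp [hf σ v]

section Topology

variable {n k : ℕ} {Z Y : Type*} [NormedAddCommGroup Z] [NormedSpace ℝ Z]
  [NormedAddCommGroup Y] [NormedSpace ℝ Y]

/-- The canonical identification `⨀ᵏ(ℝⁿ, Z) → Hom(⨀ₖ ℝⁿ, Z)`: the linear map on the symmetric
power that takes the value `ψ (v₁, …, vₖ)` at `v₁ ⊙ ⋯ ⊙ vₖ`. -/
def symLift (ψ : SymMap n k Z) : (Sym[ℝ]^k (E n)) →ₗ[ℝ] Z where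
  toFun := AddCon.lift (addConGen (SymmetricPower.Rel ℝ (Fin k) (E n)))
    (PiTensorProduct.lift ψ.1.toMultilinearMap).toAddMonoidHom (by
      refine AddCon.addConGen_le.2 ?_
      intro x y hxy
      cases hxy with
      | perm e f =>
        have h := ψ.2 e f
        simpa [AddCon.ker_rel, Function.comp_def] using h.symm)
  map_add' x y := map_add _ x y
  map_smul' c x := by
    refine AddCon.induction_on x fun x => ?_
    exact (PiTensorProduct.lift ψ.1.toMultilinearMap).map_smul c x

theorem symLift_tprod (ψ : SymMap n k Z) (v : Fin k → E n) :
    symLift ψ (⨂ₛ[ℝ] i, v i) = ψ.1 v :=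
  PiTensorProduct.lift.tprod (φ := ψ.1.toMultilinearMap) v

/-- The canonical map `⨀ᵏ(ℝⁿ, Y*) → Hom(Y ⊗ ⨀ₖ ℝⁿ, ℝ)`, given by
`⟨y ⊗ η, ψ⟩ = ⟨η, ψ⟩ (y)`. -/
def pairing (ψ : SymMap n k (StrongDual ℝ Y)) : (Y ⊗[ℝ] Sym[ℝ]^k (E n)) →ₗ[ℝ] ℝ :=
  TensorProduct.lift
    ((ContinuousLinearMap.coeLM ℝ : StrongDual ℝ Y →ₗ[ℝ] Y →ₗ[ℝ] ℝ).comp (symLift ψ)).flip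

theorem pairing_tmul (ψ : SymMap n k (StrongDual ℝ Y)) (y : Y) (v : Fin k → E n) :
    pairing ψ (y ⊗ₜ[ℝ] (⨂ₛ[ℝ] i, v i)) = ψ.1 v y := by
  simp [pairing, symLift_tprod]

variable (n k Y) in
/-- The `Y ⊗ ⨀ₖ ℝⁿ` topology on `⨀ᵏ(ℝⁿ, Y*)`: the weak topology of the duality with
`Y ⊗ ⨀ₖ ℝⁿ`, that is, the topology inherited from the product space `ℝ ^ (Y ⊗ ⨀ₖ ℝⁿ)`. -/
@[reducible]
def weakTopology : TopologicalSpace (SymMap n k (StrongDual ℝ Y)) :=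
  TopologicalSpace.induced
    (fun (ψ : SymMap n k (StrongDual ℝ Y)) (τ : Y ⊗[ℝ] Sym[ℝ]^k (E n)) => pairing ψ τ)
    Pi.topologicalSpace

/-- Evaluation at `y`: the real valued symmetric `k`-linear map
`(v₁, …, vₖ) ↦ ψ (v₁, …, vₖ) (y)`. -/
def evalAt (y : Y) (ψ : SymMap n k (StrongDual ℝ Y)) : SymMap n k ℝ :=
  ⟨(ContinuousLinearMap.apply ℝ ℝ y).compContinuousMultilinearMap ψ.1, by
    intro σ v
    simp [ψ.2 σ v]⟩

theorem evalAt_apply (y : Y) (ψ : SymMap n k (StrongDual ℝ Y)) (v : Fin k → E n) :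
    (evalAt y ψ).1 v = ψ.1 v y := rfl

end Topology

section Differentiability

variable {n : ℕ} {Z Y : Type*} [NormedAddCommGroup Z] [NormedSpace ℝ Z]
  [NormedAddCommGroup Y] [NormedSpace ℝ Y]

/-- `P : ℝⁿ → Z` is a polynomial function of degree at most `k`: a sum of homogeneous polynomial
functions `x ↦ ψₘ (x, …, x)`, `m = 0, …, k`, where `ψₘ` is a symmetric `m`-linear map. -/
def IsPolynomial (k : ℕ) (P : E n → Z) : Prop :=
  ∃ ψ : ∀ m : ℕ, SymMap n m Z,
    ∀ x, P x = ∑ m ∈ Finset.range (k + 1), (ψ m).1 (fun _ => x)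

theorem IsPolynomial.contDiff {k : ℕ} {P : E n → Z} (hP : IsPolynomial k P) :
    ContDiff ℝ (⊤ : WithTop ℕ∞) P := by
  obtain ⟨ψ, hψ⟩ := hP
  rw [funext hψ]
  refine ContDiff.sum fun m _ => ?_
  exact (ψ m).1.contDiff.comp (contDiff_pi.2 fun _ => contDiff_id)

/-- The `k`-th differential `Dᵏ P (a)`, a symmetric `k`-linear map, of a polynomial function. -/
def IsPolynomial.differential {k : ℕ} {P : E n → Z} (hP : IsPolynomial k P) (a : E n) :
    SymMap n k Z :=
  ⟨iteratedFDeriv ℝ k P a, fun σ v =>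
    hP.contDiff.contDiffAt.iteratedFDeriv_comp_perm v σ⟩

/-- The test function `x ↦ φ (r⁻¹ (x - a))`, for `r ≠ 0` (only `r > 0` is used; for `r = 0` the
value is set to be `0`). -/
def rescale (φ : TestFn n Y) (a : E n) (r : ℝ) : TestFn n Y :=
  if hr : r = 0 then 0 else
    { toFun := fun x => φ (r⁻¹ • (x - a))
      contDiff' := φ.contDiff.comp ((contDiff_id.sub contDiff_const).const_smul _)
      hasCompactSupport' := φ.hasCompactSupport.comp_homeomorph
        ((Homeomorph.subRight a).trans (Homeomorph.smulOfNeZero r⁻¹ (inv_ne_zero hr)))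
      tsupport_subset' := fun _ _ => trivial }

theorem rescale_apply (φ : TestFn n Y) (a : E n) {r : ℝ} (hr : r ≠ 0) (x : E n) :
    rescale φ a r x = φ (r⁻¹ • (x - a)) := by
  rw [rescale, dif_neg hr]
  rfl

/-- The polynomial function `P : ℝⁿ → Y*` of degree at most `k` describes the behaviour of the
distribution `T` at `a` to order `k`: with `S (φ) = ∫ ⟨φ, P⟩ dℒⁿ`, one has
`r ^ (-k-n) (T - S)ₓ (φ (r⁻¹ (x - a))) → 0` as `r → 0+` for every test function `φ`. -/
structure IsJet (T : Distrib n Y) (k : ℕ) (a : E n) (P : E n → StrongDual ℝ Y) : Prop where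
  isPolynomial : IsPolynomial k P
  tendsto : ∀ φ : TestFn n Y,
    Tendsto (fun r : ℝ => (r ^ (k + n))⁻¹ *
      (T (rescale φ a r) - ∫ x, P x (rescale φ a r x))) (𝓝[>] 0) (𝓝 0)

/-- `T` is pointwise differentiable of order `k` at `a`. -/
def PtDiffAt (T : Distrib n Y) (k : ℕ) (a : E n) : Prop :=
  ∃ P : E n → StrongDual ℝ Y, IsJet T k a P

/-- The `k`-th order pointwise differential `pt Dᵏ T (a) = Dᵏ P (a)` of `T` at `a`, where `P` is
the polynomial function in the definition of pointwise differentiability (there is only one). -/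
def ptD (T : Distrib n Y) (k : ℕ) (a : E n) (h : PtDiffAt T k a) : SymMap n k (StrongDual ℝ Y) :=
  h.choose_spec.isPolynomial.differential a

end Differentiability

end PtDiff

end

/-! A polynomial function of degree at most `k` centred at `a` amounts to a symmetric family `u` of
coefficients in `Y*`, so pointwise differentiability at `a` means that some `u` satisfies `IsCoeff T
a u`, and such `u` is unique (`IsCoeff.unique`). As `Y` is separable, closed balls of `Y*` with the
weak* topology are compact metrizable; families in a ball of radius `N` thus form a Polish space.

The relation `IsCoeff` is Borel in `(a, u)` (`measurableSet_isCoeff`). Its quantifier over all test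
functions is uncountable, but functions supported in a fixed compact set form a separable Fréchet
space. There, by Banach–Steinhaus (`forall_tendsto_zero_iff`), convergence for all test functions is
convergence on a countable dense set together with a uniform bound near zero, and for fixed `r` all
quantities are continuous in `(a, u)`. Uniqueness makes the projection `(a, u) ↦ a` injective on
this relation, so Lusin–Souslin keeps images Borel (`measurableSet_exists_mem_isCoeff`). The union
over `N` gives the first claim; adding the closed condition `u s y ≤ c` gives measurability of all
scalar components (`measurable_ptD_apply`).

The rest is deduced from the components. On bounded sets the weak topology is coarser than a second
countable one given by countably many components. For the norm topologies, closed balls are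
countable intersections of conditions on components, which suffices when the target is separable. -/

open scoped BoundedContinuousFunction

noncomputable section

namespace PtDiff

/-! ### Smooth functions with support in a fixed compact set: a separable Fréchet space -/

section FunctionSpaces

variable {V F : Type*} [NormedAddCommGroup V] [NormedSpace ℝ V] [NormedAddCommGroup F]
  [NormedSpace ℝ F]

open ContDiffMapSupportedIn in
/-- A limit, in all derivatives, of smooth functions supported in `K` is of the same kind. -/
theorem isClosed_range_structureMap (K : Compacts V) :
    IsClosed (Set.range (ContinuousLinearMap.pi (structureMapCLM ℝ ⊤) :
      𝓓_{K}(V, F) →L[ℝ] Π i, V →ᵇ (V [×i]→L[ℝ] F))) := by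
  refine IsSeqClosed.isClosed fun u g hu hg => ?_
  choose f hf using hu
  have hlim : ∀ i, Tendsto (fun j => structureMapCLM ℝ ⊤ i (f j)) atTop (𝓝 (g i)) := fun i => by
    have h := (tendsto_pi_nhds.1 hg) i
    simpa [← hf] using h
  have hunif : ∀ i, TendstoUniformly (fun j x => iteratedFDeriv ℝ i (f j) x) (g i) atTop := by
    intro i
    have h := BoundedContinuousFunction.tendsto_iff_tendstoUniformly.1 (hlim i)
    simpa [structureMapCLM_top_apply] using h
  have hpt : ∀ i x, Tendsto (fun j => iteratedFDeriv ℝ i (f j) x) atTop (𝓝 (g i x)) :=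
    fun i x => (hunif i).tendsto_at x
  -- The limits `g i` are the only possible Taylor series of `φ`; uniform convergence of the
  -- derivatives makes `g (m + 1)` the derivative of `g m`.
  let p : V → FormalMultilinearSeries ℝ V F := fun x i => g i x
  let φ : V → F := fun x => (g 0 x) 0
  have hp : HasFTaylorSeriesUpTo (⊤ : ℕ∞) φ p := by
    refine ⟨fun x => rfl, fun m _ x => ?_, fun m _ => (g m).continuous⟩
    refine hasFDerivAt_of_tendstoUniformly (l := atTop) (g := fun y => g m y)
      (g' := fun y => (g (m + 1) y).curryLeft)
      (f := fun j x => iteratedFDeriv ℝ m (f j) x)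
      (f' := fun j x => (iteratedFDeriv ℝ (m + 1) (f j) x).curryLeft) ?_ ?_ ?_ x
    · have h := (continuousMultilinearCurryLeftEquiv ℝ (fun _ : Fin (m + 1) => V)
        F).isometry.uniformContinuous.comp_tendstoUniformly (hunif (m + 1))
      exact h
    · intro j y
      exact ((f j).contDiff.ftaylorSeries).fderiv m (by exact_mod_cast ENat.natCast_lt_top m) y
    · exact fun y => hpt m y
  have hφ : ContDiff ℝ (⊤ : ℕ∞) φ := hp.contDiff
  have hzero : Set.EqOn φ 0 (K : Set V)ᶜ := by
    intro x hx
    have h : g 0 x = 0 := by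
      refine tendsto_nhds_unique (hpt 0 x) ?_
      simp [(f _).iteratedFDeriv_zero_on_compl hx]
    simp [φ, h]
  refine ⟨⟨φ, hφ, hzero⟩, ?_⟩
  funext i
  ext1 x
  have h := hp.eq_iteratedFDeriv (m := i) (by exact_mod_cast le_top) x
  simp only [ContinuousLinearMap.coe_pi', structureMapCLM_top_apply]
  exact h.symm

instance completeSpace_contDiffMapSupportedIn (K : Compacts V) [CompleteSpace F] :
    CompleteSpace 𝓓_{K}(V, F) := by
  have h := ContDiffMapSupportedIn.isUniformEmbedding_pi_structureMapCLM (𝕜 := ℝ) (n := ⊤)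
    (K := K) (E := V) (F := F)
  rw [completeSpace_iff_isComplete_range h.isUniformInducing]
  exact (isClosed_range_structureMap K).isComplete

instance isCountablyGenerated_uniformity_contDiffMapSupportedIn (K : Compacts V) :
    (uniformity 𝓓_{K}(V, F)).IsCountablyGenerated := by
  have h := ContDiffMapSupportedIn.isUniformEmbedding_pi_structureMapCLM (𝕜 := ℝ) (n := ⊤)
    (K := K) (E := V) (F := F)
  rw [← h.isUniformInducing.comap_uniformity]
  infer_instance

/-- Baire implies barrelled, which is what Banach–Steinhaus needs. -/
instance baireSpace_contDiffMapSupportedIn (K : Compacts V) [CompleteSpace F] :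
    BaireSpace 𝓓_{K}(V, F) := by
  let _ := UniformSpace.pseudoMetricSpace 𝓓_{K}(V, F)
  infer_instance

theorem secondCountable_multilinear [FiniteDimensional ℝ V] [SecondCountableTopology F] (m : ℕ) :
    SecondCountableTopology (V [×m]→L[ℝ] F) := by
  induction m with
  | zero =>
    exact (continuousMultilinearCurryFin0 ℝ V F).toHomeomorph.secondCountableTopology
  | succ m ih =>
    exact (continuousMultilinearCurryLeftEquiv ℝ (fun _ : Fin (m + 1) => V)
      F).toHomeomorph.secondCountableTopology

/-- Bounded continuous functions vanishing off a compact set form a second countable space. -/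
theorem secondCountable_boundedContinuous_support [FiniteDimensional ℝ V] {G : Type*}
    [NormedAddCommGroup G] [SecondCountableTopology G] (K : Compacts V) :
    SecondCountableTopology {g : V →ᵇ G | Set.EqOn g 0 (K : Set V)ᶜ} := by
  have : ProperSpace V := FiniteDimensional.proper ℝ V
  let ρ : {g : V →ᵇ G | Set.EqOn g 0 (K : Set V)ᶜ} → C(K, G) :=
    fun g => (g.1 : C(V, G)).restrict (K : Set V)
  have hρ : Isometry ρ := by
    refine Isometry.of_dist_eq fun g h => le_antisymm ?_ ?_
    · rw [ContinuousMap.dist_le dist_nonneg]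
      exact fun x => BoundedContinuousFunction.dist_coe_le_dist (f := g.1) (g := h.1) x.1
    · rw [Subtype.dist_eq, BoundedContinuousFunction.dist_le dist_nonneg]
      intro x
      by_cases hx : x ∈ (K : Set V)
      · exact ContinuousMap.dist_apply_le_dist (f := ρ g) (g := ρ h) ⟨x, hx⟩
      · have h1 : g.1 x = 0 := g.2 hx
        have h2 : h.1 x = 0 := h.2 hx
        rw [h1, h2, dist_self]
        exact dist_nonneg
  exact hρ.isEmbedding.isInducing.secondCountableTopology

-- All derivatives vanish off `K`, so the embedding into bounded continuous functions lands in a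
-- countable product of the second countable subspaces `S i`.
open ContDiffMapSupportedIn in
instance secondCountable_contDiffMapSupportedIn (K : Compacts V) [FiniteDimensional ℝ V]
    [SecondCountableTopology F] : SecondCountableTopology 𝓓_{K}(V, F) := by
  have h := (isUniformEmbedding_pi_structureMapCLM (𝕜 := ℝ) (n := ⊤)
    (K := K) (E := V) (F := F)).isUniformInducing.isInducing
  let S : ∀ i, Set (V →ᵇ (V [×i]→L[ℝ] F)) := fun i => {g | Set.EqOn g 0 (K : Set V)ᶜ}
  have hS : ∀ (f : 𝓓_{K}(V, F)) i, structureMapCLM ℝ ⊤ i f ∈ S i := fun f i x hx => by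
    rw [structureMapCLM_top_apply]
    exact f.iteratedFDeriv_zero_on_compl hx
  have : ∀ i, SecondCountableTopology (S i) := fun i => by
    have := secondCountable_multilinear (V := V) (F := F) i
    exact secondCountable_boundedContinuous_support K
  let θ : 𝓓_{K}(V, F) → Π i, S i := fun f i => ⟨structureMapCLM ℝ ⊤ i f, hS f i⟩
  have hθ : Continuous θ := continuous_pi fun i =>
    (structureMapCLM ℝ ⊤ i).continuous.subtype_mk _
  have hval : Continuous fun (g : Π i, S i) i => (g i).1 := by fun_prop
  have hθi : Topology.IsInducing θ := Topology.IsInducing.of_comp hθ hval h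
  exact hθi.secondCountableTopology

end FunctionSpaces

/-! ### Pointwise convergence of functionals as a Borel condition -/

section UniformBoundedness

variable {V : Type*} [AddCommGroup V] [Module ℝ V] [UniformSpace V] [IsUniformAddGroup V]
  [ContinuousSMul ℝ V]

/-- **Banach–Steinhaus**: for a one-parameter family of continuous linear functionals on a separable
barrelled space, pointwise convergence to `0` is convergence on a dense set together with
boundedness on a basic neighbourhood of `0`. -/
theorem forall_tendsto_zero_iff [BarrelledSpace ℝ V] {D : Set V} (hD : Dense D) {U : ℕ → Set V}
    (hU : (𝓝 (0 : V)).HasAntitoneBasis U) (G : ℝ → V →L[ℝ] ℝ) :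
    (∀ φ, Tendsto (fun r => G r φ) (𝓝[>] 0) (𝓝 0)) ↔
      (∀ φ ∈ D, Tendsto (fun r => G r φ) (𝓝[>] 0) (𝓝 0)) ∧
      ∃ q : ℕ, ∀ r ∈ Set.Ioo (0 : ℝ) (1 / (q + 1)), ∀ φ ∈ U q, |G r φ| ≤ 1 := by
  constructor
  · intro h
    refine ⟨fun φ _ => h φ, ?_⟩
    -- Otherwise there are `r q → 0+` and `φ q ∈ U q` with `|G (r q) (φ q)| > 1`, although the
    -- sequence `G (r q)` is pointwise bounded, hence equicontinuous at `0`.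
    by_contra! hcon
    choose r hr φ hφ hG using hcon
    have hr0 : Tendsto r atTop (𝓝[>] 0) := by
      refine tendsto_nhdsWithin_iff.2 ⟨?_, Eventually.of_forall fun q => (hr q).1⟩
      exact squeeze_zero (fun q => (hr q).1.le) (fun q => (hr q).2.le)
        tendsto_one_div_add_atTop_nhds_zero_nat
    have hbs : UniformEquicontinuous ((↑) ∘ fun q => G (r q)) :=
      (norm_withSeminorms ℝ ℝ).banach_steinhaus fun _ ψ =>
        (((h ψ).comp hr0).norm).bddAbove_range
    have heq := hbs.equicontinuous 0
    rw [Metric.equicontinuousAt_iff_right] at heq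
    obtain ⟨q, hq⟩ := hU.eventually_subset (heq 1 one_pos) |>.exists
    have h1 := hq (hφ q) q
    simp only [Function.comp_apply, map_zero, dist_zero_left, Real.norm_eq_abs] at h1
    exact absurd h1 (not_lt.2 (hG q).le)
  · rintro ⟨hlim, q, hq⟩ φ
    rw [Metric.tendsto_nhds]
    intro ε hε
    -- The scaling turns the bound `1` on `U q` into `|G r (φ - ψ)| ≤ ε / 2`.
    have hnhds : {ψ : V | (ε / 2)⁻¹ • (φ - ψ) ∈ U q} ∈ 𝓝 φ := by
      have hc : Continuous fun ψ : V => (ε / 2)⁻¹ • (φ - ψ) := by fun_prop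
      exact hc.continuousAt.preimage_mem_nhds (by simpa using hU.mem q)
    obtain ⟨ψ, hψ, hψD⟩ := mem_closure_iff_nhds.1 (hD φ) _ hnhds
    have hr : ∀ᶠ r in 𝓝[>] (0 : ℝ), r ∈ Set.Ioo (0 : ℝ) (1 / (q + 1)) :=
      Ioo_mem_nhdsGT (by positivity)
    filter_upwards [hr, Metric.tendsto_nhds.1 (hlim ψ hψD) (ε / 2) (by positivity)] with r h1 h2
    have h3 := hq r h1 _ hψ
    rw [map_smul, map_sub, smul_eq_mul, abs_mul, abs_of_pos (by positivity : 0 < (ε / 2)⁻¹),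
      inv_mul_le_iff₀ (by positivity)] at h3
    rw [Real.dist_eq, sub_zero] at h2 ⊢
    calc |G r φ| = |(G r φ - G r ψ) + G r ψ| := by ring_nf
      _ ≤ |G r φ - G r ψ| + |G r ψ| := abs_add_le _ _
      _ < ε := by linarith

/-- The intersection over `r` is uncountable, but its members are closed; hence no regularity in `r`
is required. -/
theorem measurableSet_tendsto_zero {X : Type*} [TopologicalSpace X] [MeasurableSpace X]
    [OpensMeasurableSpace X] {g : X → ℝ → ℝ} (hg : ∀ r, 0 < r → Continuous fun x => g x r) :
    MeasurableSet {x | Tendsto (g x) (𝓝[>] 0) (𝓝 0)} := by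
  have h : {x | Tendsto (g x) (𝓝[>] 0) (𝓝 0)} =
      ⋂ p : ℕ, ⋃ q : ℕ, ⋂ r ∈ Set.Ioo (0 : ℝ) (1 / (q + 1)), {x | |g x r| ≤ 1 / (p + 1)} := by
    ext x
    simp only [Set.mem_ofPred_eq, Set.mem_iInter, Set.mem_iUnion]
    constructor
    · intro h p
      have h1 := Metric.tendsto_nhds.1 h (1 / (p + 1)) (by positivity)
      obtain ⟨δ, hδ, hsub⟩ := mem_nhdsGT_iff_exists_Ioo_subset.1 h1
      obtain ⟨q, hq⟩ := exists_nat_one_div_lt (show (0 : ℝ) < δ from hδ)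
      refine ⟨q, fun r hr => ?_⟩
      have h2 : dist (g x r) 0 < 1 / (p + 1) := hsub ⟨hr.1, hr.2.trans hq⟩
      simpa [Real.dist_eq] using h2.le
    · intro h
      rw [Metric.tendsto_nhds]
      intro ε hε
      obtain ⟨p, hp⟩ := exists_nat_one_div_lt hε
      obtain ⟨q, hq⟩ := h p
      filter_upwards [Ioo_mem_nhdsGT (show (0 : ℝ) < 1 / (q + 1) by positivity)] with r hr
      rw [Real.dist_eq, sub_zero]
      exact (hq r hr).trans_lt hp
  rw [h]
  refine MeasurableSet.iInter fun p => MeasurableSet.iUnion fun q => IsClosed.measurableSet ?_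
  refine isClosed_biInter fun r hr => ?_
  exact isClosed_le (hg r hr.1).abs continuous_const

theorem measurableSet_forall_tendsto_zero [BarrelledSpace ℝ V] [SecondCountableTopology V]
    {X : Type*} [TopologicalSpace X] [MeasurableSpace X] [OpensMeasurableSpace X]
    {G : X → ℝ → V →L[ℝ] ℝ} (hG : ∀ r φ, 0 < r → Continuous fun x => G x r φ) :
    MeasurableSet {x | ∀ φ, Tendsto (fun r => G x r φ) (𝓝[>] 0) (𝓝 0)} := by
  obtain ⟨U, hU⟩ := (𝓝 (0 : V)).exists_antitone_basis
  obtain ⟨D, hDc, hD⟩ := exists_countable_dense V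
  simp_rw [forall_tendsto_zero_iff hD hU, Set.ofPred_and, Set.ofPred_exists,
    Set.ofPred_forall]
  refine MeasurableSet.inter ?_ (MeasurableSet.iUnion fun q => IsClosed.measurableSet ?_)
  · refine MeasurableSet.biInter hDc fun φ _ => ?_
    exact measurableSet_tendsto_zero fun r hr => hG r φ hr
  · refine isClosed_biInter fun r hr => isClosed_biInter fun φ _ => ?_
    exact isClosed_le (hG r φ hr.1).abs continuous_const

end UniformBoundedness

end PtDiff

namespace PtDiff

/-! ### Dependence of rescaled test functions on the centre -/

section Rescaling

variable {n : ℕ} {Y : Type*} [NormedAddCommGroup Y] [NormedSpace ℝ Y]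

/-- The inclusion of the test functions supported in `K` into `𝓓(ℝⁿ, Y)`. -/
abbrev incl (K : Compacts (E n)) : 𝓓_{K}(E n, Y) →L[ℝ] TestFn n Y :=
  TestFunction.ofSupportedInCLM ℝ (Set.subset_univ _)

theorem exists_incl_closedBall (φ : TestFn n Y) :
    ∃ (j : ℕ) (f : 𝓓_{(⟨Metric.closedBall 0 j, isCompact_closedBall _ _⟩ : Compacts (E n))}(E n, Y)),
      incl _ f = φ := by
  obtain ⟨R, hR⟩ := φ.hasCompactSupport.isCompact.isBounded.subset_closedBall 0
  obtain ⟨j, hj⟩ := exists_nat_ge R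
  refine ⟨j, .of_support_subset φ.contDiff ((subset_tsupport _).trans (hR.trans
    (Metric.closedBall_subset_closedBall hj))), ?_⟩
  ext x
  rfl

-- For `a` near `a₀` the translates of `ψ` are supported in one compact set `K`, and they depend
-- continuously on `a` in `𝓓_{K}` because each derivative of `ψ` is uniformly continuous.
open scoped Pointwise in
theorem continuous_apply_rescale (T : Distrib n Y) (φ : TestFn n Y) {r : ℝ} (hr : r ≠ 0) :
    Continuous fun a => T (rescale φ a r) := by
  let ψ : TestFn n Y := rescale φ 0 r
  have hψ : ∀ a x, rescale φ a r x = ψ (x - a) := fun a x => by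
    simp only [ψ, rescale_apply _ _ hr, sub_zero]
  rw [continuous_iff_continuousAt]
  intro a₀
  let B : Set (E n) := Metric.closedBall a₀ 1
  let K : Compacts (E n) := ⟨B + tsupport ψ, (isCompact_closedBall a₀ 1).add ψ.hasCompactSupport⟩
  have hsupp : ∀ a : B, Set.EqOn (fun x => ψ (x - a.1)) 0 (K : Set (E n))ᶜ := by
    intro a x hx
    by_contra h
    exact hx ⟨a, a.2, x - a, subset_tsupport _ h, add_sub_cancel _ _⟩
  let θ : B → 𝓓_{K}(E n, Y) := fun a => ⟨fun x => ψ (x - a.1),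
    ψ.contDiff.comp (contDiff_id.sub contDiff_const), hsupp a⟩
  have hθ : Continuous θ := by
    rw [ContDiffMapSupportedIn.continuous_iff_comp]
    intro i
    have huc : UniformContinuous (iteratedFDeriv ℝ i ψ) :=
      (ψ.hasCompactSupport.iteratedFDeriv i).uniformContinuous_of_continuous
        (ψ.contDiff.continuous_iteratedFDeriv (by exact_mod_cast le_top))
    rw [Metric.uniformContinuous_iff] at huc
    rw [Metric.continuous_iff]
    intro b ε hε
    obtain ⟨δ, hδ, h⟩ := huc (ε / 2) (by positivity)
    refine ⟨δ, hδ, fun a hab => lt_of_le_of_lt ?_ (half_lt_self hε)⟩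
    rw [BoundedContinuousFunction.dist_le (by positivity)]
    intro x
    simp only [Function.comp_apply, ContDiffMapSupportedIn.structureMapCLM_top_apply]
    have hd : ∀ c : B, iteratedFDeriv ℝ i (θ c) x = iteratedFDeriv ℝ i ψ (x - c.1) :=
      fun c => iteratedFDeriv_comp_sub i c.1 x
    rw [hd, hd]
    refine (h ?_).le
    rwa [dist_sub_left]
  have hcont : ContinuousOn (fun a => T (rescale φ a r)) B := by
    rw [continuousOn_iff_continuous_domRestrict]
    have h := T.continuous.comp ((incl K).continuous.comp hθ)
    refine h.congr fun a => ?_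
    refine congrArg T ?_
    ext x
    exact (hψ a x).symm
  exact hcont.continuousAt (Metric.closedBall_mem_nhds a₀ one_pos)

/-- Rescaling as a continuous linear map between spaces of functions with fixed supports. -/
def rescaleCLM (K : Compacts (E n)) (a : E n) (r : ℝ) (hr : r ≠ 0) :
    𝓓_{K}(E n, Y) →L[ℝ] 𝓓_{K.map (fun x => a + r • x) (by fun_prop)}(E n, Y) :=
  ContDiffMapSupportedIn.mkCLM ℝ (fun f x => f (r⁻¹ • (x - a)))
    (fun f g x => rfl) (fun c f x => rfl)
    (fun f => f.contDiff.comp ((contDiff_id.sub contDiff_const).const_smul _))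
    (fun f x hx => f.zero_on_compl fun h => hx ⟨_, h, by
      simp [smul_smul, mul_inv_cancel₀ hr]⟩)
    (fun i _ => ⟨{i}, |r⁻¹| ^ i, by positivity, fun f x _ => by
      have h1 : iteratedFDeriv ℝ i (fun x => f (r⁻¹ • (x - a))) x =
          iteratedFDeriv ℝ i (fun x => f (r⁻¹ • x)) (x - a) :=
        iteratedFDeriv_comp_sub (f := fun x => f (r⁻¹ • x)) i a x
      rw [h1, iteratedFDeriv_comp_const_smul _ (f.contDiff.of_le (by exact_mod_cast le_top)),
        norm_smul, norm_pow, Real.norm_eq_abs, Finset.sup_singleton]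
      gcongr
      exact ContDiffMapSupportedIn.norm_iteratedFDeriv_apply_le_seminorm_top ℝ⟩)

/-- The functional `f ↦ T (f (r⁻¹ (x - a)))` on the functions supported in `K`. -/
def evalRescale (T : Distrib n Y) (K : Compacts (E n)) (a : E n) (r : ℝ) : 𝓓_{K}(E n, Y) →L[ℝ] ℝ :=
  if hr : r = 0 then 0 else T.comp ((incl _).comp (rescaleCLM K a r hr))

theorem evalRescale_apply (T : Distrib n Y) (K : Compacts (E n)) (a : E n) (r : ℝ)
    (f : 𝓓_{K}(E n, Y)) : evalRescale T K a r f = T (rescale (incl K f) a r) := by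
  by_cases hr : r = 0
  · simp [evalRescale, hr, rescale]
  · rw [evalRescale, dif_neg hr]
    refine congrArg T ?_
    ext x
    rw [rescale_apply _ _ hr]
    rfl

end Rescaling

end PtDiff

namespace PtDiff

/-! ### Polynomial functions and their symmetric coefficients -/

section Polynomials

variable {n k : ℕ} {Z : Type*} [NormedAddCommGroup Z] [NormedSpace ℝ Z]

/-- The standard basis vectors of `ℝⁿ`. -/
abbrev stdVec (i : Fin n) : E n := EuclideanSpace.single i 1

/-- The monomial function `x ↦ x_{s₁} ⋯ x_{sₘ}`. -/
def mono {m : ℕ} (s : Fin m → Fin n) (x : E n) : ℝ := ∏ i, x (s i)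

theorem continuous_mono {m : ℕ} (s : Fin m → Fin n) : Continuous (mono s) := by
  unfold mono
  fun_prop

theorem mono_smul {m : ℕ} (s : Fin m → Fin n) (r : ℝ) (x : E n) :
    mono s (r • x) = r ^ m * mono s x := by
  simp [mono, Finset.prod_mul_distrib]

theorem multilinear_expansion {m : ℕ} (ψ : ContinuousMultilinearMap ℝ (fun _ : Fin m => E n) Z)
    (v : Fin m → E n) :
    ψ v = ∑ s : Fin m → Fin n, (∏ i, v i (s i)) • ψ (fun i => stdVec (s i)) := by
  have hv : v = fun i => ∑ j, v i j • stdVec j := by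
    funext i
    ext l
    simp [stdVec, Finset.sum_apply, Pi.single_apply]
  conv_lhs => rw [hv]
  rw [ψ.map_sum]
  exact Finset.sum_congr rfl fun s _ => ψ.map_smul_univ _ _

/-- The symmetric multilinear map with given symmetric coefficients. -/
def ofCoeff {m : ℕ} (u : (Fin m → Fin n) → Z)
    (hu : ∀ (σ : Equiv.Perm (Fin m)) s, u (s ∘ σ) = u s) : SymMap n m Z :=
  ⟨∑ s, ((ContinuousMultilinearMap.mkPiAlgebra ℝ (Fin m) ℝ).compContinuousLinearMap
    (fun i => EuclideanSpace.proj (s i))).smulRight (u s), by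
    intro σ v
    simp only [sum_apply, ContinuousMultilinearMap.smulRight_apply,
      ContinuousMultilinearMap.compContinuousLinearMap_apply,
      ContinuousMultilinearMap.mkPiAlgebra_apply, PiLp.proj_apply, Function.comp_apply]
    refine (Fintype.sum_equiv (Equiv.arrowCongr σ.symm (Equiv.refl _)) _ _ fun s => ?_).symm
    have h1 : (Equiv.arrowCongr σ.symm (Equiv.refl (Fin n))) s = s ∘ σ := by
      ext i; simp
    rw [h1, hu]
    congr 1
    exact (Equiv.prod_comp σ fun i => v i (s i)).symm⟩

theorem ofCoeff_apply {m : ℕ} (u : (Fin m → Fin n) → Z)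
    (hu : ∀ (σ : Equiv.Perm (Fin m)) s, u (s ∘ σ) = u s) (v : Fin m → E n) :
    (ofCoeff u hu).1 v = ∑ s, (∏ i, v i (s i)) • u s := by
  simp [ofCoeff]

theorem ofCoeff_stdVec {m : ℕ} (u : (Fin m → Fin n) → Z)
    (hu : ∀ (σ : Equiv.Perm (Fin m)) s, u (s ∘ σ) = u s) (s : Fin m → Fin n) :
    (ofCoeff u hu).1 (fun i => stdVec (s i)) = u s := by
  rw [ofCoeff_apply, Finset.sum_eq_single s]
  · simp [stdVec]
  · intro t _ hts
    obtain ⟨i, hi⟩ := Function.ne_iff.1 hts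
    rw [Finset.prod_eq_zero (Finset.mem_univ i), zero_smul]
    simp [stdVec, hi]
  · simp

/-- A polynomial function with homogeneous components `ψ`, as a finite power series. -/
theorem hasFiniteFPowerSeriesOnBall_sum {P : E n → Z} {ψ : ∀ m : ℕ, SymMap n m Z}
    (hP : ∀ x, P x = ∑ m ∈ Finset.range (k + 1), (ψ m).1 (fun _ => x)) :
    HasFiniteFPowerSeriesOnBall P (fun m => if m ≤ k then (ψ m).1 else 0) 0 (k + 1) ⊤ := by
  refine HasFiniteFPowerSeriesOnBall.mk' (fun m hm => if_neg (by omega)) ENNReal.zero_lt_top ?_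
  intro y _
  rw [zero_add, hP]
  refine Finset.sum_congr rfl fun m hm => ?_
  rw [if_pos (Nat.lt_succ_iff.1 (Finset.mem_range.1 hm))]

theorem iteratedFDeriv_zero_of_sum [CompleteSpace Z] {P : E n → Z} {ψ : ∀ m : ℕ, SymMap n m Z}
    (hP : ∀ x, P x = ∑ m ∈ Finset.range (k + 1), (ψ m).1 (fun _ => x)) {m : ℕ} (hm : m ≤ k)
    (v : Fin m → E n) : iteratedFDeriv ℝ m P 0 v = (m.factorial : ℝ) • (ψ m).1 v := by
  rw [(hasFiniteFPowerSeriesOnBall_sum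
    hP).toHasFPowerSeriesOnBall.iteratedFDeriv_eq_sum_of_completeSpace]
  simp only [if_pos hm]
  have h : ∀ σ : Equiv.Perm (Fin m), (ψ m).1 (fun i => v (σ i)) = (ψ m).1 v := fun σ =>
    (ψ m).2 σ v
  simp [h, Fintype.card_perm, Nat.cast_smul_eq_nsmul]

/-- Taylor's formula for polynomial functions. -/
theorem IsPolynomial.taylor [CompleteSpace Z] {P : E n → Z} (hP : IsPolynomial k P) (a z : E n) :
    P (a + z) = ∑ m ∈ Finset.range (k + 1),
      ((m.factorial : ℝ)⁻¹ • iteratedFDeriv ℝ m P a) (fun _ => z) := by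
  obtain ⟨ψ, hψ⟩ := hP
  have h := (hasFiniteFPowerSeriesOnBall_sum hψ).changeOrigin (y := a) ENNReal.coe_lt_top
  rw [zero_add, ENNReal.top_sub_coe] at h
  rw [h.eq_partialSum' (a + z) (by simp) (k + 1) le_rfl, FormalMultilinearSeries.partialSum]
  refine Finset.sum_congr rfl fun m _ => ?_
  rw [smul_apply,
    h.toHasFPowerSeriesOnBall.iteratedFDeriv_eq_sum_of_completeSpace]
  -- On the diagonal the `m!` permuted terms agree, which cancels the factor `(m!)⁻¹`.
  simp only [Finset.sum_const, Finset.card_univ, Fintype.card_perm, Fintype.card_fin,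
    add_sub_cancel_left]
  rw [← Nat.cast_smul_eq_nsmul ℝ, smul_smul, inv_mul_cancel₀ (by positivity), one_smul]

theorem IsPolynomial.comp_add [CompleteSpace Z] {P : E n → Z} (hP : IsPolynomial k P) (a : E n) :
    IsPolynomial k (fun x => P (a + x)) := by
  refine ⟨fun m => (m.factorial : ℝ)⁻¹ • ⟨iteratedFDeriv ℝ m P a, fun σ v =>
    hP.contDiff.contDiffAt.iteratedFDeriv_comp_perm v σ⟩, fun x => ?_⟩
  exact hP.taylor a x

/-- Indices of the coefficients of a polynomial of degree at most `k`. -/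
abbrev Idx (n k : ℕ) : Type := Σ m : Fin (k + 1), (Fin m → Fin n)

/-- Symmetry of coefficients. -/
def IsSymm (u : Idx n k → Z) : Prop :=
  ∀ (m : Fin (k + 1)) (σ : Equiv.Perm (Fin m)) (s : Fin m → Fin n), u ⟨m, s ∘ σ⟩ = u ⟨m, s⟩

/-- The polynomial function with coefficients `u`. -/
def polyOf (u : Idx n k → Z) (z : E n) : Z := ∑ s, mono s.2 z • u s

theorem continuous_polyOf (u : Idx n k → Z) : Continuous (polyOf u) :=
  continuous_finsetSum _ fun s _ => (continuous_mono s.2).smul continuous_const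

/-- The homogeneous components of the polynomial function with symmetric coefficients `u`. -/
def IsSymm.component {u : Idx n k → Z} (hu : IsSymm u) (m : ℕ) : SymMap n m Z :=
  if h : m < k + 1 then ofCoeff (fun s => u ⟨⟨m, h⟩, s⟩) (hu ⟨m, h⟩) else 0

theorem IsSymm.component_apply {u : Idx n k → Z} (hu : IsSymm u) (m : Fin (k + 1)) :
    hu.component m = ofCoeff (fun s => u ⟨m, s⟩) (hu m) :=
  dif_pos m.2

theorem IsSymm.polyOf_eq_sum {u : Idx n k → Z} (hu : IsSymm u) (x : E n) :
    polyOf u x = ∑ m ∈ Finset.range (k + 1), (hu.component m).1 (fun _ => x) := by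
  rw [polyOf, Fintype.sum_sigma, Finset.sum_range]
  refine Finset.sum_congr rfl fun m _ => ?_
  rw [hu.component_apply, ofCoeff_apply]
  rfl

theorem IsSymm.isPolynomial [CompleteSpace Z] {u : Idx n k → Z} (hu : IsSymm u) (a : E n) :
    IsPolynomial k (fun x => polyOf u (x - a)) := by
  have h : IsPolynomial k (polyOf u) := ⟨hu.component, hu.polyOf_eq_sum⟩
  simpa [sub_eq_neg_add] using h.comp_add (-a)

theorem IsSymm.iteratedFDeriv_polyOf [CompleteSpace Z] {u : Idx n k → Z} (hu : IsSymm u)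
    (s : Idx n k) : iteratedFDeriv ℝ s.1 (polyOf u) 0 (fun i => stdVec (s.2 i)) =
      ((s.1 : ℕ).factorial : ℝ) • u s := by
  rw [iteratedFDeriv_zero_of_sum hu.polyOf_eq_sum (Nat.lt_succ_iff.1 s.1.2), hu.component_apply,
    ofCoeff_stdVec]

/-- Reordered index tuples give the same monomial, so symmetry is what lets the derivatives at `0`
recover the coefficients. -/
theorem IsSymm.eq_zero_of_polyOf [CompleteSpace Z] {u : Idx n k → Z} (hu : IsSymm u)
    (h : polyOf u = 0) : u = 0 := by
  funext s
  have h1 := hu.iteratedFDeriv_polyOf s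
  rw [h, iteratedFDeriv_zero] at h1
  have h2 : ((s.1 : ℕ).factorial : ℝ) ≠ 0 := by positivity
  exact (smul_eq_zero.1 h1.symm).resolve_left h2

/-- The Taylor coefficients of `P` at `a`. -/
def taylorCoeff (k : ℕ) (P : E n → Z) (a : E n) (s : Idx n k) : Z :=
  ((s.1 : ℕ).factorial : ℝ)⁻¹ • iteratedFDeriv ℝ s.1 P a (fun i => stdVec (s.2 i))

theorem IsPolynomial.isSymm_taylorCoeff {P : E n → Z} (hP : IsPolynomial k P) (a : E n) :
    IsSymm (taylorCoeff k P a) := by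
  intro m σ s
  simp only [taylorCoeff]
  congr 1
  exact hP.contDiff.contDiffAt.iteratedFDeriv_comp_perm (fun i => stdVec (s i)) σ

theorem IsPolynomial.polyOf_taylorCoeff [CompleteSpace Z] {P : E n → Z} (hP : IsPolynomial k P)
    (a x : E n) : polyOf (taylorCoeff k P a) (x - a) = P x := by
  conv_rhs => rw [← add_sub_cancel a x, hP.taylor]
  rw [polyOf, Fintype.sum_sigma, Finset.sum_range]
  refine Finset.sum_congr rfl fun m _ => ?_
  rw [smul_apply, multilinear_expansion, Finset.smul_sum]
  refine Finset.sum_congr rfl fun s _ => ?_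
  rw [taylorCoeff, smul_comm]
  rfl

end Polynomials

end PtDiff

/-! ### Differentiability in terms of coefficients, and uniqueness -/

namespace PtDiff

/-- An expansion `∑ rᵐ cₘ = o(rᵏ)` with exponents at most `k` is trivial. -/
theorem eq_zero_of_tendsto_sum {k : ℕ} {c : ℕ → ℝ}
    (h : Tendsto (fun r : ℝ => (r ^ k)⁻¹ * ∑ m ∈ Finset.range (k + 1), r ^ m * c m)
      (𝓝[>] 0) (𝓝 0)) {m : ℕ} (hm : m ≤ k) : c m = 0 := by
  induction m using Nat.strong_induction_on with
  | _ m ih =>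
    have hid : Tendsto (fun r : ℝ => r) (𝓝[>] 0) (𝓝 0) := tendsto_nhdsWithin_of_tendsto_nhds
      tendsto_id
    -- This replaces the normalisation `r⁻ᵏ` by `r⁻ᵐ`; terms below `m` vanish by induction and those
    -- above tend to `0`, leaving `c m`.
    have h1 : Tendsto (fun r : ℝ => r ^ (k - m) *
        ((r ^ k)⁻¹ * ∑ m ∈ Finset.range (k + 1), r ^ m * c m)) (𝓝[>] 0) (𝓝 0) := by
      simpa using (hid.pow (k - m)).mul h
    have h2 : Tendsto (fun r : ℝ => ∑ j ∈ Finset.range (k + 1),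
        if m ≤ j then r ^ (j - m) * c j else 0) (𝓝[>] 0) (𝓝 (c m)) := by
      have h3 : Tendsto (fun r : ℝ => ∑ j ∈ Finset.range (k + 1),
          if m ≤ j then r ^ (j - m) * c j else 0) (𝓝[>] 0)
          (𝓝 (∑ j ∈ Finset.range (k + 1), if m ≤ j then (0 : ℝ) ^ (j - m) * c j else 0)) := by
        refine tendsto_finsetSum _ fun j _ => ?_
        split_ifs
        · exact (hid.pow _).mul_const _
        · exact tendsto_const_nhds
      convert h3 using 2
      rw [Finset.sum_eq_single m]
      · simp
      · intro j _ hj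
        split_ifs with hmj
        · rw [zero_pow (by omega), zero_mul]
        · rfl
      · intro hm'
        exact absurd (Finset.mem_range.2 (Nat.lt_succ_of_le hm)) hm'
    refine tendsto_nhds_unique h2 (h1.congr' ?_)
    filter_upwards [self_mem_nhdsWithin] with r (hr : 0 < r)
    rw [← mul_assoc, Finset.mul_sum]
    refine Finset.sum_congr rfl fun j hj => ?_
    split_ifs with hmj
    · have hk : r ^ k = r ^ (k - m) * r ^ m := by rw [← pow_add, Nat.sub_add_cancel hm]
      have hj' : r ^ j = r ^ (j - m) * r ^ m := by rw [← pow_add, Nat.sub_add_cancel hmj]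
      rw [hk, hj']
      field_simp
    · rw [ih j (not_le.1 hmj) ((not_le.1 hmj).le.trans hm), mul_zero, mul_zero]

section Jets

variable {n k : ℕ} {Y : Type*} [NormedAddCommGroup Y] [NormedSpace ℝ Y]

/-- The moment `∫ z_{s₁} ⋯ z_{sₘ} φ(z) dz` of a test function. -/
def moment {m : ℕ} (s : Fin m → Fin n) : TestFn n Y →L[ℝ] Y :=
  TestFunction.integralAgainstBilinCLM (ContinuousLinearMap.lsmul ℝ ℝ).flip volume (mono s)

theorem moment_apply {m : ℕ} (s : Fin m → Fin n) (φ : TestFn n Y) :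
    moment s φ = ∫ z, mono s z • φ z := by
  rw [moment, TestFunction.integralAgainstBilinCLM_eq_integral
    ((continuous_mono s).locallyIntegrable.locallyIntegrableOn _)]
  rfl

theorem integrable_mono_smul {m : ℕ} (s : Fin m → Fin n) (φ : TestFn n Y) :
    Integrable fun z => mono s z • φ z :=
  ((continuous_mono s).smul φ.continuous).integrable_of_hasCompactSupport
    φ.hasCompactSupport.smul_left

theorem integral_polyOf [CompleteSpace Y] (u : Idx n k → StrongDual ℝ Y) (φ : TestFn n Y) (r : ℝ) :
    ∫ z, polyOf u (r • z) (φ z) = ∑ s, r ^ (s.1 : ℕ) * u s (moment s.2 φ) := by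
  have h : ∀ z, polyOf u (r • z) (φ z) = ∑ s, r ^ (s.1 : ℕ) * u s (mono s.2 z • φ z) := by
    intro z
    simp only [polyOf, mono_smul, sum_apply, smul_apply, map_smul, smul_eq_mul]
    exact Finset.sum_congr rfl fun s _ => by ring
  simp_rw [h]
  rw [integral_finsetSum _ fun s _ => ((u s).integrable_comp
    (integrable_mono_smul s.2 φ)).const_mul _]
  refine Finset.sum_congr rfl fun s _ => ?_
  rw [integral_const_mul, (u s).integral_comp_comm (integrable_mono_smul s.2 φ), moment_apply]

/-- Substitution `x = a + r z`, with Jacobian `r ^ n`. -/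
theorem integral_polyOf_rescale [CompleteSpace Y] (u : Idx n k → StrongDual ℝ Y) (φ : TestFn n Y)
    (a : E n) {r : ℝ} (hr : 0 < r) :
    ∫ x, polyOf u (x - a) (rescale φ a r x) =
      r ^ n * ∑ s, r ^ (s.1 : ℕ) * u s (moment s.2 φ) := by
  have h : ∀ x, polyOf u (x - a) (rescale φ a r x) =
      (fun y => (fun z => polyOf u (r • z) (φ z)) (r⁻¹ • y)) (x - a) := fun x => by
    simp only [rescale_apply _ _ hr.ne', smul_smul, mul_inv_cancel₀ hr.ne', one_smul]
  simp_rw [h]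
  rw [integral_sub_right_eq_self (fun y => (fun z => polyOf u (r • z) (φ z)) (r⁻¹ • y)) a,
    Measure.integral_comp_inv_smul_of_nonneg _ (fun z => polyOf u (r • z) (φ z)) hr.le,
    finrank_euclideanSpace_fin, smul_eq_mul,
    integral_polyOf]

/-- The remainder of the expansion with coefficients `u` of the distribution `T` at `a`. -/
def remainder (T : Distrib n Y) (a : E n) (u : Idx n k → StrongDual ℝ Y) (φ : TestFn n Y)
    (r : ℝ) : ℝ :=
  (r ^ (k + n))⁻¹ *
    (T (rescale φ a r) - r ^ n * ∑ s, r ^ (s.1 : ℕ) * u s (moment s.2 φ))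

/-- The coefficients `u` describe the behaviour of `T` at `a` to order `k`. -/
structure IsCoeff (T : Distrib n Y) (a : E n) (u : Idx n k → StrongDual ℝ Y) : Prop where
  isSymm : IsSymm u
  tendsto : ∀ φ : TestFn n Y, Tendsto (remainder T a u φ) (𝓝[>] 0) (𝓝 0)

variable {T : Distrib n Y} {a : E n} [CompleteSpace Y]

theorem tendsto_remainder_iff {u : Idx n k → StrongDual ℝ Y} {φ : TestFn n Y} :
    Tendsto (remainder T a u φ) (𝓝[>] 0) (𝓝 0) ↔
      Tendsto (fun r : ℝ => (r ^ (k + n))⁻¹ *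
        (T (rescale φ a r) - ∫ x, polyOf u (x - a) (rescale φ a r x))) (𝓝[>] 0) (𝓝 0) := by
  refine tendsto_congr' ?_
  filter_upwards [self_mem_nhdsWithin] with r hr
  rw [remainder, integral_polyOf_rescale u φ a hr]

theorem IsJet.isCoeff {P : E n → StrongDual ℝ Y} (h : IsJet T k a P) :
    IsCoeff T a (taylorCoeff k P a) := by
  refine ⟨h.isPolynomial.isSymm_taylorCoeff a, fun φ => tendsto_remainder_iff.2 ?_⟩
  simpa only [h.isPolynomial.polyOf_taylorCoeff] using h.tendsto φ

theorem IsCoeff.isJet {u : Idx n k → StrongDual ℝ Y} (h : IsCoeff T a u) :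
    IsJet T k a (fun x => polyOf u (x - a)) :=
  ⟨h.isSymm.isPolynomial a, fun φ => tendsto_remainder_iff.1 (h.tendsto φ)⟩

/-- Testing with `φ = g • y` for scalar `g` reduces this to the fundamental lemma of the calculus of
variations for the continuous function `z ↦ polyOf w z y`. -/
theorem polyOf_eq_zero_of_moment {w : Idx n k → StrongDual ℝ Y}
    (h : ∀ φ : TestFn n Y, ∑ s, w s (moment s.2 φ) = 0) : polyOf w = 0 := by
  funext x
  ext y
  have hc : Continuous fun z => polyOf w z y := (continuous_polyOf w).clm_apply continuous_const
  have hae : ∀ᵐ z, polyOf w z y = 0 := by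
    refine ae_eq_zero_of_integral_contDiff_smul_eq_zero hc.locallyIntegrable fun g hg hgc => ?_
    let φ : TestFn n Y := ⟨fun z => g z • y, hg.smul contDiff_const, hgc.smul_right,
      fun _ _ => trivial⟩
    have h1 := integral_polyOf w φ 1
    simp only [one_smul, one_pow, one_mul, h φ] at h1
    rw [← h1]
    refine integral_congr_ae (Eventually.of_forall fun z => ?_)
    exact ((polyOf w z).map_smul (g z) y).symm
  exact congrFun (Continuous.ae_eq_iff_eq volume hc continuous_const |>.1 hae) x

/-- Uniqueness of the polynomial in the definition of pointwise differentiability. -/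
theorem IsCoeff.unique {u w : Idx n k → StrongDual ℝ Y} (hu : IsCoeff T a u)
    (hw : IsCoeff T a w) : u = w := by
  have hsymm : IsSymm (w - u) := fun m σ s => by
    simp [hu.isSymm m σ s, hw.isSymm m σ s]
  refine (sub_eq_zero.1 (hsymm.eq_zero_of_polyOf (polyOf_eq_zero_of_moment fun φ => ?_))).symm
  -- The moments grouped by degree. In the difference of the two remainders `T` cancels, so `∑ rᵐ c
  -- m = o(rᵏ)`.
  let c : ℕ → ℝ := fun m => if h : m < k + 1 then
    ∑ s : Fin m → Fin n, (w - u) ⟨⟨m, h⟩, s⟩ (moment s φ) else 0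
  have hc : ∀ r : ℝ, ∑ s, r ^ (s.1 : ℕ) * (w - u) s (moment s.2 φ) =
      ∑ m ∈ Finset.range (k + 1), r ^ m * c m := fun r => by
    rw [Fintype.sum_sigma, Finset.sum_range]
    refine Finset.sum_congr rfl fun m _ => ?_
    have hcm : c m = ∑ s : Fin m → Fin n, (w - u) ⟨m, s⟩ (moment s φ) := dif_pos m.2
    rw [hcm, Finset.mul_sum]
  have hlim : Tendsto (fun r : ℝ => (r ^ k)⁻¹ * ∑ m ∈ Finset.range (k + 1), r ^ m * c m)
      (𝓝[>] 0) (𝓝 0) := by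
    have h := (hu.tendsto φ).sub (hw.tendsto φ)
    rw [sub_zero] at h
    refine h.congr' ?_
    filter_upwards [self_mem_nhdsWithin] with r (hr : 0 < r)
    simp only [← hc, remainder, Pi.sub_apply, sub_apply, mul_sub, Finset.sum_sub_distrib]
    rw [pow_add]
    field_simp
    ring
  have h0 : ∀ m ∈ Finset.range (k + 1), c m = 0 := fun m hm =>
    eq_zero_of_tendsto_sum hlim (Nat.lt_succ_iff.1 (Finset.mem_range.1 hm))
  have h1 := hc 1
  simp only [one_pow, one_mul] at h1
  rw [h1, Finset.sum_eq_zero h0]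

theorem ptDiffAt_iff : PtDiffAt T k a ↔ ∃ u : Idx n k → StrongDual ℝ Y, IsCoeff T a u :=
  ⟨fun ⟨_, hP⟩ => ⟨_, hP.isCoeff⟩, fun ⟨_, hu⟩ => ⟨_, hu.isJet⟩⟩

/-- By uniqueness the polynomial chosen in `ptD` has the coefficients `u`. -/
theorem IsCoeff.ptD_stdVec {u : Idx n k → StrongDual ℝ Y} (hu : IsCoeff T a u)
    (h : PtDiffAt T k a) (s : Fin k → Fin n) :
    (ptD T k a h).1 (fun i => stdVec (s i)) = (k.factorial : ℝ) • u ⟨Fin.last k, s⟩ := by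
  have h1 : taylorCoeff k h.choose a ⟨Fin.last k, s⟩ = (k.factorial : ℝ)⁻¹ •
    (ptD T k a h).1 (fun i => stdVec (s i)) := rfl
  rw [← h.choose_spec.isCoeff.unique hu, h1, smul_inv_smul₀ (by positivity)]

end Jets

end PtDiff

namespace PtDiff

/-! ### Borel sets of centres, by projection from a Polish space of coefficients -/

section Coefficients

variable {n k : ℕ} {Y : Type*} [NormedAddCommGroup Y] [NormedSpace ℝ Y]

variable (Y) in
/-- The closed ball of radius `N` in `Y*`, with the weak* topology. -/
abbrev DualBall (N : ℕ) : Type _ :=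
  ↥(WeakDual.toStrongDual ⁻¹' Metric.closedBall (0 : StrongDual ℝ Y) N : Set (WeakDual ℝ Y))

instance compactSpace_dualBall (N : ℕ) : CompactSpace (DualBall Y N) :=
  isCompact_iff_compactSpace.1 (WeakDual.isCompact_closedBall (0 : StrongDual ℝ Y) N)

instance polishSpace_dualBall [SeparableSpace Y] (N : ℕ) : PolishSpace (DualBall Y N) := by
  have : MetrizableSpace (DualBall Y N) :=
    WeakDual.metrizable_of_isCompact ℝ Y _ (WeakDual.isCompact_closedBall _ _)
  let _ := metrizableSpaceMetric (DualBall Y N)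
  infer_instance

/-- Families of functionals in a ball of `Y*`, as families of functionals. -/
def toDual {N : ℕ} (u : Idx n k → DualBall Y N) : Idx n k → StrongDual ℝ Y :=
  fun s => WeakDual.toStrongDual (u s).1

theorem continuous_toDual_apply {N : ℕ} (s : Idx n k) (y : Y) :
    Continuous fun u : Idx n k → DualBall Y N => toDual u s y :=
  (WeakDual.eval_continuous y).comp (continuous_subtype_val.comp (continuous_apply s))

theorem toDual_injective {N : ℕ} :
    Function.Injective (toDual : (Idx n k → DualBall Y N) → _) := fun u w h => by
  funext s
  exact Subtype.ext (WeakDual.toStrongDual.injective (congrFun h s))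

theorem exists_toDual (u : Idx n k → StrongDual ℝ Y) :
    ∃ (N : ℕ) (w : Idx n k → DualBall Y N), toDual w = u := by
  obtain ⟨N, hN⟩ := exists_nat_ge ‖u‖
  refine ⟨N, fun s => ⟨StrongDual.toWeakDual (u s), ?_⟩, rfl⟩
  simpa using (norm_le_pi_norm u s).trans hN

/-- The remainder as a continuous linear functional of the test function. -/
def remainderCLM (T : Distrib n Y) (K : Compacts (E n)) (a : E n) (u : Idx n k → StrongDual ℝ Y)
    (r : ℝ) : 𝓓_{K}(E n, Y) →L[ℝ] ℝ :=
  (r ^ (k + n))⁻¹ • (evalRescale T K a r -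
    r ^ n • ∑ s, r ^ (s.1 : ℕ) • (u s).comp ((moment s.2).comp (incl K)))

theorem remainderCLM_apply (T : Distrib n Y) (K : Compacts (E n)) (a : E n)
    (u : Idx n k → StrongDual ℝ Y) (r : ℝ) (f : 𝓓_{K}(E n, Y)) :
    remainderCLM T K a u r f = remainder T a u (incl K f) r := by
  simp only [remainderCLM, remainder, smul_apply, sub_apply, sum_apply,
    ContinuousLinearMap.comp_apply, evalRescale_apply, smul_eq_mul]

theorem isClosed_isSymm (N : ℕ) :
    IsClosed {u : Idx n k → DualBall Y N | IsSymm (toDual u)} := by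
  simp only [IsSymm, Set.ofPred_forall]
  refine isClosed_iInter fun m => isClosed_iInter fun σ => isClosed_iInter fun s => ?_
  simp only [toDual, WeakDual.toStrongDual.injective.eq_iff]
  exact isClosed_eq (continuous_subtype_val.comp (continuous_apply _))
    (continuous_subtype_val.comp (continuous_apply _))

variable [CompleteSpace Y] [SeparableSpace Y] (T : Distrib n Y)

/-- Test functions are exhausted by the spaces for the balls of integer radius `j`; on each,
`measurableSet_forall_tendsto_zero` applies, since for fixed `r > 0` and `f` the remainder is
jointly continuous in the centre and the weak* coefficients. -/
theorem measurableSet_isCoeff (N : ℕ) [MeasurableSpace (E n × (Idx n k → DualBall Y N))]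
    [BorelSpace (E n × (Idx n k → DualBall Y N))] :
    MeasurableSet {x : E n × (Idx n k → DualBall Y N) | IsCoeff T x.1 (toDual x.2)} := by
  have : SecondCountableTopology Y := UniformSpace.secondCountable_of_separable Y
  have h : {x : E n × (Idx n k → DualBall Y N) | IsCoeff T x.1 (toDual x.2)} =
      Prod.snd ⁻¹' {u | IsSymm (toDual u)} ∩ ⋂ j : ℕ, {x | ∀ f, Tendsto (fun r =>
        remainderCLM T (⟨Metric.closedBall 0 j, isCompact_closedBall _ _⟩ : Compacts (E n))
          x.1 (toDual x.2) r f) (𝓝[>] 0) (𝓝 0)} := by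
    ext x
    simp only [remainderCLM_apply, Set.mem_inter_iff, Set.mem_iInter, Set.mem_preimage,
      Set.mem_ofPred_eq]
    refine ⟨fun h => ⟨h.isSymm, fun j f => h.tendsto _⟩, fun h => ⟨h.1, fun φ => ?_⟩⟩
    obtain ⟨j, f, rfl⟩ := exists_incl_closedBall φ
    exact h.2 j f
  rw [h]
  refine ((isClosed_isSymm N).preimage continuous_snd).measurableSet.inter
    (MeasurableSet.iInter fun j => measurableSet_forall_tendsto_zero fun r f hr => ?_)
  simp only [remainderCLM_apply, remainder]
  refine continuous_const.mul (((continuous_apply_rescale T _ hr.ne').comp continuous_fst).sub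
    (continuous_const.mul (continuous_finsetSum _ fun s _ => continuous_const.mul ?_)))
  exact (continuous_toDual_apply s _).comp continuous_snd

theorem measurableSet_exists_mem_isCoeff (N : ℕ) {C : Set (Idx n k → DualBall Y N)}
    (hC : IsClosed C) : MeasurableSet {a : E n | ∃ u ∈ C, IsCoeff T a (toDual u)} := by
  let _ : MeasurableSpace (E n × (Idx n k → DualBall Y N)) := borel _
  have : BorelSpace (E n × (Idx n k → DualBall Y N)) := ⟨rfl⟩
  have h : {a : E n | ∃ u ∈ C, IsCoeff T a (toDual u)} = Prod.fst ''
      ({x : E n × (Idx n k → DualBall Y N) | IsCoeff T x.1 (toDual x.2)} ∩ Prod.snd ⁻¹' C) := by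
    ext a
    constructor
    · rintro ⟨u, huC, hu⟩
      exact ⟨(a, u), ⟨hu, huC⟩, rfl⟩
    · rintro ⟨⟨b, u⟩, ⟨hu, huC⟩, rfl⟩
      exact ⟨u, huC, hu⟩
  rw [h]
  -- Lusin–Souslin; without injectivity the projection would only be analytic.
  refine MeasurableSet.image_of_continuousOn_injOn ((measurableSet_isCoeff T N).inter
    (hC.preimage continuous_snd).measurableSet) continuous_fst.continuousOn ?_
  rintro ⟨a, u⟩ ⟨hu, -⟩ ⟨b, w⟩ ⟨hw, -⟩ (rfl : a = b)
  exact Prod.ext rfl (toDual_injective (hu.unique hw))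

theorem measurableSet_ptDiffAt : MeasurableSet {a : E n | PtDiffAt T k a} := by
  have h : {a : E n | PtDiffAt T k a} =
      ⋃ N : ℕ, {a | ∃ u ∈ (Set.univ : Set (Idx n k → DualBall Y N)), IsCoeff T a (toDual u)} := by
    ext a
    simp only [Set.mem_ofPred_eq, ptDiffAt_iff, Set.mem_iUnion, Set.mem_univ, true_and]
    constructor
    · rintro ⟨u, hu⟩
      obtain ⟨N, w, rfl⟩ := exists_toDual u
      exact ⟨N, w, hu⟩
    · rintro ⟨N, w, hw⟩
      exact ⟨_, hw⟩
  rw [h]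
  exact MeasurableSet.iUnion fun N => measurableSet_exists_mem_isCoeff T N isClosed_univ

theorem measurableSet_exists_isCoeff_apply_le (s : Idx n k) (y : Y) (c : ℝ) :
    MeasurableSet {a : E n | ∃ u : Idx n k → StrongDual ℝ Y, IsCoeff T a u ∧ u s y ≤ c} := by
  have h : {a : E n | ∃ u : Idx n k → StrongDual ℝ Y, IsCoeff T a u ∧ u s y ≤ c} =
      ⋃ N : ℕ, {a | ∃ u ∈ {u : Idx n k → DualBall Y N | toDual u s y ≤ c},
        IsCoeff T a (toDual u)} := by
    ext a
    simp only [Set.mem_ofPred_eq, Set.mem_iUnion]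
    constructor
    · rintro ⟨u, hu, hc⟩
      obtain ⟨N, w, rfl⟩ := exists_toDual u
      exact ⟨N, w, hc, hu⟩
    · rintro ⟨N, w, hc, hw⟩
      exact ⟨_, hw, hc⟩
  rw [h]
  exact MeasurableSet.iUnion fun N => measurableSet_exists_mem_isCoeff T N
    (isClosed_le (continuous_toDual_apply s y) continuous_const)

/-- The scalar components of the pointwise differential are Borel functions. -/
theorem measurable_ptD_apply (v : Fin k → E n) (y : Y) :
    Measurable fun a : {a : E n // PtDiffAt T k a} => (ptD T k a.1 a.2).1 v y := by
  have h : ∀ s : Fin k → Fin n, Measurable fun a : {a : E n // PtDiffAt T k a} =>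
      (ptD T k a.1 a.2).1 (fun i => stdVec (s i)) y := by
    intro s
    refine measurable_of_Iic fun c => ?_
    refine ⟨_, measurableSet_exists_isCoeff_apply_le T (⟨Fin.last k, s⟩ : Idx n k) y
      (c / k.factorial), ?_⟩
    ext a
    obtain ⟨u, hu⟩ := ptDiffAt_iff.1 a.2
    have hk : (0 : ℝ) < k.factorial := by positivity
    simp only [Set.mem_preimage, Set.mem_ofPred_eq, Set.mem_Iic, hu.ptD_stdVec a.2 s, smul_apply,
      smul_eq_mul, le_div_iff₀' hk]
    exact ⟨fun ⟨w, hw, hc⟩ => by rwa [hu.unique hw], fun hc => ⟨u, hu, hc⟩⟩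
  simp_rw [multilinear_expansion _ v, sum_apply, smul_apply, smul_eq_mul]
  exact Finset.measurable_fun_sum _ fun s _ => (h s).const_mul _

end Coefficients

end PtDiff

/-! ### From measurable components to Borel maps into spaces of symmetric maps -/

namespace PtDiff

/-- A map into a separable metric space is measurable if the preimages of closed balls are. -/
theorem measurable_of_preimage_closedBall {Ω M : Type*} [MeasurableSpace Ω] [PseudoMetricSpace M]
    [SecondCountableTopology M] [MeasurableSpace M] [BorelSpace M] {f : Ω → M}
    (h : ∀ x r, MeasurableSet (f ⁻¹' Metric.closedBall x r)) : Measurable f := by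
  refine measurable_of_isOpen fun U hU => ?_
  let S : Set (Set M) := {B | ∃ x r, B = Metric.closedBall x r ∧ B ⊆ U}
  have hS : ⋃₀ S = U := by
    refine Set.Subset.antisymm (Set.sUnion_subset fun B ⟨_, _, _, hB⟩ => hB) fun x hx => ?_
    obtain ⟨r, hr, hB⟩ := Metric.nhds_basis_closedBall.mem_iff.1 (hU.mem_nhds hx)
    exact ⟨_, ⟨x, r, rfl, hB⟩, Metric.mem_closedBall_self hr.le⟩
  -- Interiors are used so that the Lindelöf property yields a countable subfamily.
  have hint : ⋃ B ∈ S, interior B = U := by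
    refine Set.Subset.antisymm (Set.iUnion₂_subset fun B ⟨_, _, _, hB⟩ =>
      interior_subset.trans hB) fun x hx => ?_
    obtain ⟨r, hr, hB⟩ := Metric.nhds_basis_closedBall.mem_iff.1 (hU.mem_nhds hx)
    exact Set.mem_biUnion (⟨x, r, rfl, hB⟩ : _ ∈ S)
      (Metric.ball_subset_interior_closedBall (Metric.mem_ball_self hr))
  obtain ⟨C, hCS, hC, hCU⟩ := isOpen_biUnion_countable S interior fun _ _ => isOpen_interior
  have hU' : U = ⋃ B ∈ C, B := by
    refine Set.Subset.antisymm ?_ (Set.iUnion₂_subset fun B hB => ?_)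
    · rw [← hint, ← hCU]
      exact Set.iUnion₂_mono fun B _ => interior_subset
    · rw [← hS]
      exact Set.subset_sUnion_of_mem (hCS hB)
  rw [hU', Set.preimage_iUnion₂]
  refine MeasurableSet.biUnion hC fun B hB => ?_
  obtain ⟨x, r, rfl, -⟩ := hCS hB
  exact h x r

section Measurability

variable {n k : ℕ} {Ω : Type*} [MeasurableSpace Ω]

theorem norm_le_iff_of_dense {Z : Type*} [NormedAddCommGroup Z] [NormedSpace ℝ Z]
    {D : Set (Fin k → E n)} (hD : Dense D) (ψ : ContinuousMultilinearMap ℝ (fun _ : Fin k => E n) Z)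
    {c : ℝ} (hc : 0 ≤ c) : ‖ψ‖ ≤ c ↔ ∀ v ∈ D, ‖ψ v‖ ≤ c * ∏ i, ‖v i‖ := by
  rw [ContinuousMultilinearMap.opNorm_le_iff hc]
  refine ⟨fun h v _ => h v, fun h v => ?_⟩
  refine hD.induction h (isClosed_le ψ.cont.norm ?_) v
  fun_prop

theorem dual_norm_le_iff_of_dense {Y : Type*} [NormedAddCommGroup Y] [NormedSpace ℝ Y]
    {D : Set Y} (hD : Dense D) (f : StrongDual ℝ Y) {c : ℝ} (hc : 0 ≤ c) :
    ‖f‖ ≤ c ↔ ∀ y ∈ D, ‖f y‖ ≤ c * ‖y‖ := by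
  rw [ContinuousLinearMap.opNorm_le_iff hc]
  refine ⟨fun h v _ => h v, fun h v => ?_⟩
  exact hD.induction h (isClosed_le f.continuous.norm (by fun_prop)) v

/-- A map into `⨀ᵏ(ℝⁿ, Z)`, `Z` separable, is a Borel map if preimages of balls under its values are
measurable. -/
theorem measurable_symMap_of_apply {Z : Type*} [NormedAddCommGroup Z] [NormedSpace ℝ Z]
    [SecondCountableTopology Z] {f : Ω → SymMap n k Z}
    (h : ∀ (v : Fin k → E n) (z : Z) (c : ℝ), 0 ≤ c → MeasurableSet {ω | ‖(f ω).1 v - z‖ ≤ c}) :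
    @Measurable _ _ _ (borel _) f := by
  have := secondCountable_multilinear (V := E n) (F := Z) k
  let _ : MeasurableSpace (SymMap n k Z) := borel _
  have : BorelSpace (SymMap n k Z) := ⟨rfl⟩
  refine measurable_of_preimage_closedBall fun ψ c => ?_
  rcases lt_or_ge c 0 with hc | hc
  · rw [Metric.closedBall_eq_empty.2 hc]
    exact MeasurableSet.empty
  obtain ⟨D, hDc, hD⟩ := exists_countable_dense (Fin k → E n)
  have heq : f ⁻¹' Metric.closedBall ψ c =
      ⋂ v ∈ D, {ω | ‖(f ω).1 v - ψ.1 v‖ ≤ c * ∏ i, ‖v i‖} := by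
    ext ω
    simp only [Set.mem_preimage, Metric.mem_closedBall, dist_eq_norm, Set.mem_iInter,
      Set.mem_ofPred_eq]
    exact norm_le_iff_of_dense hD ((f ω).1 - ψ.1) hc
  rw [heq]
  exact MeasurableSet.biInter hDc fun v _ => h v _ _ (by positivity)

variable {Y : Type*} [NormedAddCommGroup Y] [NormedSpace ℝ Y]

/-- A dual norm bound is tested on a countable dense subset of `Y`; separability of `Y*` plays no
role at this stage. -/
theorem measurableSet_dual_norm_le [SeparableSpace Y] {g : Ω → StrongDual ℝ Y}
    (hg : ∀ y, Measurable fun ω => g ω y) (z : StrongDual ℝ Y) {c : ℝ} (hc : 0 ≤ c) :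
    MeasurableSet {ω | ‖g ω - z‖ ≤ c} := by
  obtain ⟨D, hDc, hD⟩ := exists_countable_dense Y
  have heq : {ω | ‖g ω - z‖ ≤ c} = ⋂ y ∈ D, {ω | ‖g ω y - z y‖ ≤ c * ‖y‖} := by
    ext ω
    simp only [Set.mem_iInter, Set.mem_ofPred_eq]
    exact dual_norm_le_iff_of_dense hD (g ω - z) hc
  rw [heq]
  exact MeasurableSet.biInter hDc fun y _ =>
    measurableSet_le ((hg y).sub_const _).norm measurable_const

/-- The elements of `⨀ᵏ(ℝⁿ, Y*)` whose coefficients have norm at most `N`. -/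
def coeffBall (n k : ℕ) (Y : Type*) [NormedAddCommGroup Y] [NormedSpace ℝ Y] (N : ℕ) :
    Set (SymMap n k (StrongDual ℝ Y)) :=
  {ψ | ∀ s : Fin k → Fin n, ‖ψ.1 (fun i => stdVec (s i))‖ ≤ N}

/-- The topology of pointwise convergence of the coefficients on a set `D`. -/
@[reducible]
def evalTopology (n k : ℕ) {Y : Type*} [NormedAddCommGroup Y] [NormedSpace ℝ Y] (D : Set Y) :
    TopologicalSpace (SymMap n k (StrongDual ℝ Y)) :=
  TopologicalSpace.induced (fun ψ (p : (Fin k → Fin n) × D) =>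
    ψ.1 (fun i => stdVec (p.1 i)) p.2.1) Pi.topologicalSpace

/-- With `D` countable, the Borel sets of the product of copies of `ℝ` are generated by the
coordinates. -/
theorem measurable_evalTopology {D : Set Y} (hD : D.Countable)
    {f : Ω → SymMap n k (StrongDual ℝ Y)} (hf : ∀ v y, Measurable fun ω => (f ω).1 v y) :
    @Measurable _ _ _ (@borel _ (evalTopology n k D)) f := by
  have := hD.to_subtype
  have h : @borel _ (evalTopology n k D) = MeasurableSpace.comap
      (fun ψ (p : (Fin k → Fin n) × D) => ψ.1 (fun i => stdVec (p.1 i)) p.2.1) (borel _) :=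
    borel_comap
  rw [h, measurable_comap_iff, ← BorelSpace.measurable_eq]
  exact measurable_pi_lambda _ fun p => hf _ _

/-- On bounded sets the weak topology is coarser than that of pointwise convergence of the
coefficients on a dense set. -/
theorem continuousOn_pairing {D : Set Y} (hD : Dense D) (N : ℕ) (τ : Y ⊗[ℝ] Sym[ℝ]^k (E n)) :
    @ContinuousOn _ _ (evalTopology n k D) _ (fun ψ => pairing ψ τ) (coeffBall n k Y N) := by
  let _ := evalTopology n k D
  have hind : Continuous (fun (ψ : SymMap n k (StrongDual ℝ Y)) (p : (Fin k → Fin n) × D) =>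
    ψ.1 (fun i => stdVec (p.1 i)) p.2.1) := continuous_induced_dom
  have hcoeff : ∀ (s : Fin k → Fin n) (y : Y), ContinuousOn
      (fun ψ : SymMap n k (StrongDual ℝ Y) => ψ.1 (fun i => stdVec (s i)) y)
      (coeffBall n k Y N) := by
    intro s y
    -- Replacing `y` by a nearby `y' ∈ D` changes the value by at most `N * ‖y - y'‖`, uniformly on
    -- `coeffBall`; `N + 1` avoids division by zero.
    refine continuousOn_of_uniform_approx_of_continuousOn fun u hu => ?_
    obtain ⟨ε, hε, hεu⟩ := Metric.mem_uniformity_dist.1 hu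
    obtain ⟨y', hy', hyD⟩ := Metric.mem_closure_iff.1 (hD y) (ε / (N + 1)) (by positivity)
    refine ⟨fun ψ => ψ.1 (fun i => stdVec (s i)) y',
      ((continuous_apply ((s, ⟨y', hy'⟩) : (Fin k → Fin n) × D)).comp hind).continuousOn,
      fun ψ hψ => hεu ?_⟩
    rw [dist_eq_norm, ← map_sub]
    calc ‖ψ.1 (fun i => stdVec (s i)) (y - y')‖ ≤ N * ‖y - y'‖ :=
          (ψ.1 (fun i => stdVec (s i))).le_of_opNorm_le (hψ s) _
      _ ≤ (N + 1) * ‖y - y'‖ := by gcongr; linarith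
      _ < (N + 1) * (ε / (N + 1)) := by
          rw [← dist_eq_norm]
          gcongr
      _ = ε := by field_simp
  have hval : ∀ (v : Fin k → E n) (y : Y), ContinuousOn
      (fun ψ : SymMap n k (StrongDual ℝ Y) => ψ.1 v y) (coeffBall n k Y N) := by
    intro v y
    have h : ∀ ψ : SymMap n k (StrongDual ℝ Y), ψ.1 v y =
        ∑ s : Fin k → Fin n, (∏ i, v i (s i)) * ψ.1 (fun i => stdVec (s i)) y := fun ψ => by
      rw [multilinear_expansion, sum_apply]
      rfl
    simp_rw [h]
    exact continuousOn_finsetSum _ fun s _ => continuousOn_const.mul (hcoeff s y)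
  induction τ using TensorProduct.induction_on with
  | zero => simpa using continuousOn_const
  | add x y hx hy =>
    simp only [map_add]
    exact hx.add hy
  | tmul y η =>
    have hη : ∀ ψ : SymMap n k (StrongDual ℝ Y), pairing ψ (y ⊗ₜ[ℝ] η) = symLift ψ η y :=
      fun ψ => rfl
    simp_rw [hη]
    refine AddCon.induction_on η fun ξ => ?_
    change ContinuousOn (fun ψ : SymMap n k (StrongDual ℝ Y) =>
      PiTensorProduct.lift ψ.1.toMultilinearMap ξ y) _
    induction ξ using PiTensorProduct.induction_on with
    | smul_tprod r v =>
      simp only [map_smul, PiTensorProduct.lift.tprod, smul_apply, smul_eq_mul]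
      exact continuousOn_const.mul (hval v y)
    | add x y hx hy =>
      simp only [map_add, add_apply]
      exact hx.add hy

/-- A map into `⨀ᵏ(ℝⁿ, Y*)` with measurable components is a Borel map for the weak topology. -/
theorem measurable_weakTopology [SeparableSpace Y] {f : Ω → SymMap n k (StrongDual ℝ Y)}
    (hf : ∀ v y, Measurable fun ω => (f ω).1 v y) :
    @Measurable _ _ _ (@borel _ (weakTopology n k Y)) f := by
  obtain ⟨D, hDc, hD⟩ := exists_countable_dense Y
  have hfD := measurable_evalTopology hDc hf
  have hball : ∀ N, MeasurableSet (f ⁻¹' coeffBall n k Y N) := fun N => by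
    have h : f ⁻¹' coeffBall n k Y N =
        ⋂ s : Fin k → Fin n, {ω | ‖(f ω).1 (fun i => stdVec (s i)) - 0‖ ≤ N} := by
      ext ω
      simp [coeffBall]
    rw [h]
    exact MeasurableSet.iInter fun s => measurableSet_dual_norm_le (hf _) 0 (by positivity)
  have hcover : ∀ ψ : SymMap n k (StrongDual ℝ Y), ∃ N, ψ ∈ coeffBall n k Y N := fun ψ => by
    obtain ⟨N, hN⟩ := exists_nat_ge ‖fun s : Fin k → Fin n => ψ.1 (fun i => stdVec (s i))‖
    exact ⟨N, fun s => (norm_le_pi_norm (fun s : Fin k → Fin n =>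
      ψ.1 (fun i => stdVec (s i))) s).trans hN⟩
  refine @measurable_generateFrom _ _ _ _ _ fun U hU => ?_
  -- The weak topology need not be second countable, but on each `coeffBall` a weakly open set
  -- agrees with one open for `evalTopology`, and countably many such balls cover the space.
  have hloc : ∀ N, ∃ U', IsOpen[evalTopology n k D] U' ∧
      U ∩ coeffBall n k Y N = U' ∩ coeffBall n k Y N := fun N => by
    let _ := evalTopology n k D
    obtain ⟨W, hW, rfl⟩ := isOpen_induced_iff.1 hU
    have hc : ContinuousOn (fun (ψ : SymMap n k (StrongDual ℝ Y))
        (τ : Y ⊗[ℝ] Sym[ℝ]^k (E n)) => pairing ψ τ) (coeffBall n k Y N) :=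
      continuousOn_pi.2 fun τ => continuousOn_pairing hD N τ
    exact continuousOn_iff'.1 hc W hW
  choose U' hU' hUU' using hloc
  have h : f ⁻¹' U = ⋃ N, f ⁻¹' (U' N) ∩ f ⁻¹' coeffBall n k Y N := by
    simp_rw [← Set.preimage_inter, ← hUU', Set.preimage_inter, ← Set.inter_iUnion]
    refine (Set.inter_eq_left.2 fun ω _ => Set.mem_iUnion.2 (hcover (f ω))).symm
  rw [h]
  exact MeasurableSet.iUnion fun N =>
    (hfD (MeasurableSpace.measurableSet_generateFrom (hU' N))).inter (hball N)

end Measurability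

end PtDiff

end

theorem theorem4p12 (n k : ℕ) {Y : Type*} [NormedAddCommGroup Y] [NormedSpace ℝ Y]
    [CompleteSpace Y] [SeparableSpace Y] (T : PtDiff.Distrib n Y) :
    MeasurableSet {a : PtDiff.E n | PtDiff.PtDiffAt T k a} ∧
    @Measurable {a : PtDiff.E n // PtDiff.PtDiffAt T k a} _
      inferInstance (@borel _ (PtDiff.weakTopology n k Y))
      (fun a => PtDiff.ptD T k a.1 a.2) ∧
    (∀ y : Y,
      @Measurable {a : PtDiff.E n // PtDiff.PtDiffAt T k a} (PtDiff.SymMap n k ℝ)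
        inferInstance (borel _)
        (fun a => PtDiff.evalAt y (PtDiff.ptD T k a.1 a.2))) ∧
    (SeparableSpace (StrongDual ℝ Y) →
      @Measurable {a : PtDiff.E n // PtDiff.PtDiffAt T k a} (PtDiff.SymMap n k (StrongDual ℝ Y))
        inferInstance (borel _)
        (fun a => PtDiff.ptD T k a.1 a.2)) := by
  have h := PtDiff.measurable_ptD_apply (k := k) T
  refine ⟨PtDiff.measurableSet_ptDiffAt T, PtDiff.measurable_weakTopology h, fun y => ?_,
    fun hsep => ?_⟩
  · exact PtDiff.measurable_symMap_of_apply fun v z c _ =>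
      measurableSet_le ((h v y).sub_const z).norm measurable_const
  · have := UniformSpace.secondCountable_of_separable (StrongDual ℝ Y)
    exact PtDiff.measurable_symMap_of_apply fun v z c hc =>
      PtDiff.measurableSet_dual_norm_le (h v) z hc
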